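/- For $0 < u \le 1$ let $\zeta(s,u)$ be the Hurwitz zeta function (the meromorphic continuation of $\sum_{n\ge 0}(n+u)^{-s}$), and let the generalised Stieltjes constants $\gamma_p(u)$, $p \ge 0$, be defined by its Laurent expansion about $s=1$, $$\zeta(s,u) = \frac{1}{s-1} + \sum_{p=0}^{\infty} \frac{(-1)^p}{p!}\,\gamma_p(u)\,(s-1)^p .$$ Write $\gamma_1 = \gamma_1(1)$ and let $\gamma$ be Euler's constant. Then $$\gamma_1\left(\tfrac14\right) = \tfrac12\left[2\gamma_1 - 7\log^2 2 - 6\gamma\log 2\right] - \tfrac12\pi\left[\gamma + 4\log 2 + 3\log\pi - 4\log\Gamma\left(\tfrac14\right)\right]$$ and $$\gamma_1\left(\tfrac34\right) = \tfrac12\left[2\gamma_1 - 7\log^2 2 - 6\gamma\log 2\right] + \tfrac12\pi\left[\gamma + 4\log 2 + 3\log\pi - 4\log\Gamma\left(\tfrac14\right)\right].$$ -/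

import Mathlib

open Filter Topology

/-- The regular part `ζ(s, u) - 1 / (s - 1)` of the Hurwitz zeta function at its pole `s = 1`, for
`0 < u ≤ 1`. At `s = 1` itself it takes its limiting value, so that it is an entire function of `s`
(see `differentiable_hurwitzRegularPart`). -/
noncomputable def hurwitzRegularPart (u : ℝ) : ℂ → ℂ :=
  Function.update (fun s : ℂ => HurwitzZeta.hurwitzZeta (u : UnitAddCircle) s - 1 / (s - 1)) 1
    (limUnder (𝓝[≠] (1 : ℂ))
      fun s : ℂ => HurwitzZeta.hurwitzZeta (u : UnitAddCircle) s - 1 / (s - 1))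

/-- The generalised Stieltjes constant `γ_p(u)`, for `0 < u ≤ 1`: the coefficient in the Laurent
expansion `ζ(s, u) = 1 / (s - 1) + ∑ p, (-1) ^ p / p! * γ_p(u) * (s - 1) ^ p` of the Hurwitz zeta
function about `s = 1` (see `hasSum_stieltjesConstant`). The constant `γ_p` of the Riemann zeta
function is `γ_p(1)`. -/
noncomputable def stieltjesConstant (p : ℕ) (u : ℝ) : ℂ :=
  (-1) ^ p * iteratedDeriv p (hurwitzRegularPart u) 1

theorem hurwitzRegularPart_of_ne {u : ℝ} {s : ℂ} (hs : s ≠ 1) :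
    hurwitzRegularPart u s = HurwitzZeta.hurwitzZeta (u : UnitAddCircle) s - 1 / (s - 1) := by
  simp [hurwitzRegularPart, hs]

theorem differentiable_hurwitzRegularPart (u : ℝ) : Differentiable ℂ (hurwitzRegularPart u) := by
  rw [← differentiableOn_univ]
  refine Complex.differentiableOn_update_limUnder_of_isLittleO univ_mem ?_ ?_
  · intro s hs
    have hs1 : s ≠ 1 := by simpa using hs
    refine DifferentiableAt.differentiableWithinAt ?_
    refine (HurwitzZeta.differentiableAt_hurwitzZeta _ hs1).sub ?_
    exact (differentiableAt_const _).div (by fun_prop) (sub_ne_zero.mpr hs1)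
  · rw [Asymptotics.isLittleO_iff_tendsto']
    · have h := (HurwitzZeta.hurwitzZeta_residue_one (u : UnitAddCircle)).sub_const 1
      have h2 : Tendsto (fun s : ℂ => (s - 1) *
          (HurwitzZeta.hurwitzZeta (u : UnitAddCircle) 1 - 1 / ((1 : ℂ) - 1)))
          (𝓝[≠] (1 : ℂ)) (𝓝 0) := by
        have : ContinuousAt (fun s : ℂ => (s - 1) *
          (HurwitzZeta.hurwitzZeta (u : UnitAddCircle) 1 - 1 / ((1 : ℂ) - 1))) 1 := by fun_prop
        have h3 := this.tendsto.mono_left (nhdsWithin_le_nhds (s := {1}ᶜ))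
        simpa using h3
      have h4 := h.sub h2
      simp only [sub_self] at h4
      refine h4.congr' ?_
      filter_upwards [self_mem_nhdsWithin] with s hs
      have hs1 : s - 1 ≠ 0 := sub_ne_zero.mpr (by simpa using hs)
      field_simp
      simp
    · filter_upwards [self_mem_nhdsWithin] with s hs h0
      have hs1 : s - 1 ≠ 0 := sub_ne_zero.mpr (by simpa using hs)
      exact absurd h0 (inv_ne_zero hs1)

/-- The Laurent expansion of the Hurwitz zeta function about `s = 1`. -/
theorem hasSum_stieltjesConstant (u : ℝ) {s : ℂ} (hs : s ≠ 1) :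
    HasSum (fun p : ℕ => (-1) ^ p / (p.factorial : ℂ) * stieltjesConstant p u * (s - 1) ^ p)
      (HurwitzZeta.hurwitzZeta (u : UnitAddCircle) s - 1 / (s - 1)) := by
  have h := Complex.hasSum_taylorSeries_of_entire (differentiable_hurwitzRegularPart u) 1 s
  rw [hurwitzRegularPart_of_ne hs] at h
  refine h.congr_fun ?_
  intro p
  have h1 : ((-1 : ℂ)) ^ p * (-1) ^ p = 1 := by rw [← mul_pow]; simp
  simp only [stieltjesConstant, smul_eq_mul, div_eq_mul_inv]
  linear_combination ((p.factorial : ℂ)⁻¹ * iteratedDeriv p (hurwitzRegularPart u) 1 *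
    (s - 1) ^ p) * h1

/-! The constants at 1/4 and 3/4 are recovered from their sum and difference. The sum comes from
ζ(s,1/4) + ζ(s,3/4) = (4^s - 2^s) ζ(s), expanded to second order at s = 1
(`deriv_hurwitzRegularPart_quarter_add`). In the difference ζ(s,1/4) - ζ(s,3/4) = 4^s L(s,χ₄) the
poles cancel, and its derivative at 1 is needed. The functional equation carries this to s = 0
(`deriv_hurwitzZetaOdd_quarter_one`). There, subtracting (s/2) ζ(s+1) leaves a series converging
near 0; differentiating it termwise gives log Γ(1/4) - log Γ(3/4) - γ/2 by Euler's limit for Γ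
(`tendsto_sum_quarter`), and reflection removes Γ(3/4). -/

/-! ### Hurwitz zeta at quarters and characters mod 4. -/

theorem three_quarters_eq_neg_quarter :
    ((3 / 4 : ℝ) : UnitAddCircle) = -((1 / 4 : ℝ) : UnitAddCircle) := by
  rw [← QuotientAddGroup.mk_neg, QuotientAddGroup.eq]
  exact ⟨-1, by norm_num⟩

theorem zmod_four_toAddCircle_one :
    ZMod.toAddCircle (1 : ZMod 4) = ((1 / 4 : ℝ) : UnitAddCircle) := by
  have := ZMod.toAddCircle_natCast (N := 4) 1
  simpa using this

theorem zmod_four_toAddCircle_three :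
    ZMod.toAddCircle (3 : ZMod 4) = -((1 / 4 : ℝ) : UnitAddCircle) := by
  rw [← zmod_four_toAddCircle_one, ← map_neg]; congr 1

/-- The alternating Dirichlet series of the nontrivial character mod 4 in terms of Hurwitz zeta. -/
theorem sinZeta_quarter (s : ℂ) :
    HurwitzZeta.sinZeta ((1 / 4 : ℝ) : UnitAddCircle) s =
      2 * (4 : ℂ) ^ (-s) * HurwitzZeta.hurwitzZetaOdd ((1 / 4 : ℝ) : UnitAddCircle) s := by
  -- The additive characters n ↦ i^n and n ↦ (-i)^n differ by 2i χ₄(n), so the even classes drop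
  -- out.
  have h1 := ZMod.LFunction_stdAddChar_eq_expZeta (N := 4) 1 s (Or.inl (by decide))
  have h3 := ZMod.LFunction_stdAddChar_eq_expZeta (N := 4) 3 s (Or.inl (by decide))
  have e1 : ZMod.stdAddChar (N := 4) 1 = Complex.I := by
    have := ZMod.stdAddChar_coe (N := 4) 1
    rw [Int.cast_one] at this
    rw [this]
    convert Complex.exp_pi_div_two_mul_I using 2
    push_cast; ring
  have e2 : ZMod.stdAddChar (N := 4) 2 = -1 := by
    rw [show (2 : ZMod 4) = 1 + 1 by decide, AddChar.map_add_eq_mul, e1, Complex.I_mul_I]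
  have e3 : ZMod.stdAddChar (N := 4) 3 = -Complex.I := by
    rw [show (3 : ZMod 4) = 2 + 1 by decide, AddChar.map_add_eq_mul, e1, e2]; ring
  rw [zmod_four_toAddCircle_one] at h1
  rw [zmod_four_toAddCircle_three] at h3
  rw [HurwitzZeta.sinZeta_eq, ← h1, ← h3, ZMod.LFunction, ZMod.LFunction,
    HurwitzZeta.hurwitzZetaOdd_eq, ← zmod_four_toAddCircle_three, ← zmod_four_toAddCircle_one]
  have hu : (Finset.univ : Finset (ZMod 4)) = {0, 1, 2, 3} := by decide
  have h33 : (3 * 3 : ZMod 4) = 1 := by decide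
  have h32 : (3 * 2 : ZMod 4) = 2 := by decide
  rw [hu]
  simp only [show ∀ f : ZMod 4 → ℂ, ∑ x ∈ ({0, 1, 2, 3} : Finset (ZMod 4)), f x
    = f 0 + f 1 + f 2 + f 3 from fun f => by
      rw [Finset.sum_insert (by decide), Finset.sum_insert (by decide),
        Finset.sum_insert (by decide), Finset.sum_singleton]; ring,
    one_mul, mul_one, mul_zero, h33, h32, e1, e2, e3, AddChar.map_zero_eq_one]
  have hI := Complex.I_ne_zero
  field_simp
  push_cast
  ring

/-- The trivial character mod 4 has L-function (1 - 2^(-s)) ζ(s), which is also 4^(-s) times the sum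
over the odd classes. -/
theorem hurwitzZeta_quarter_add {s : ℂ} (hs : s ≠ 1) :
    HurwitzZeta.hurwitzZeta ((1 / 4 : ℝ) : UnitAddCircle) s +
      HurwitzZeta.hurwitzZeta ((3 / 4 : ℝ) : UnitAddCircle) s =
      ((4 : ℂ) ^ s - 2 ^ s) * riemannZeta s := by
  have h := DirichletCharacter.LFunctionTrivChar_eq_mul_riemannZeta (N := 4) hs
  rw [DirichletCharacter.LFunctionTrivChar, DirichletCharacter.LFunction, ZMod.LFunction,
    show Nat.primeFactors 4 = {2} by
      rw [show 4 = 2 ^ 2 by norm_num, Nat.primeFactors_prime_pow (by norm_num) Nat.prime_two],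
    Finset.prod_singleton] at h
  have hu : (Finset.univ : Finset (ZMod 4)) = {0, 1, 2, 3} := by decide
  have m0 : (1 : DirichletCharacter ℂ 4) 0 = 0 := MulChar.map_nonunit _ (by decide)
  have m2 : (1 : DirichletCharacter ℂ 4) 2 = 0 := MulChar.map_nonunit _ (by decide)
  have m1 : (1 : DirichletCharacter ℂ 4) 1 = 1 := map_one _
  have m3 : (1 : DirichletCharacter ℂ 4) 3 = 1 := MulChar.one_apply (by decide)
  rw [hu, Finset.sum_insert (by decide), Finset.sum_insert (by decide),
        Finset.sum_insert (by decide), Finset.sum_singleton, m0, m1, m2, m3,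
        zmod_four_toAddCircle_one, zmod_four_toAddCircle_three,
        ← three_quarters_eq_neg_quarter] at h
  have h4 : (4 : ℂ) ^ s ≠ 0 := by simp [Complex.cpow_eq_zero_iff]
  have h2 : (2 : ℂ) ^ s ≠ 0 := by simp [Complex.cpow_eq_zero_iff]
  have h42 : (4 : ℂ) ^ s = 2 ^ s * 2 ^ s := by
    have := Complex.natCast_mul_natCast_cpow 2 2 s
    norm_num at this
    exact this
  push_cast at h
  rw [Complex.cpow_neg, Complex.cpow_neg] at h
  field_simp at h
  rw [h42] at h ⊢
  simp only [zero_mul, zero_add] at h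
  apply mul_right_cancel₀ h2
  linear_combination h

/-- The polar parts cancel, and continuity extends the identity to s = 1. -/
theorem hurwitzRegularPart_quarter_sub (s : ℂ) :
    hurwitzRegularPart (1 / 4) s - hurwitzRegularPart (3 / 4) s =
      2 * HurwitzZeta.hurwitzZetaOdd ((1 / 4 : ℝ) : UnitAddCircle) s := by
  have hc : Continuous fun s => hurwitzRegularPart (1 / 4) s - hurwitzRegularPart (3 / 4) s :=
    ((differentiable_hurwitzRegularPart _).sub (differentiable_hurwitzRegularPart _)).continuous
  have hc' : Continuous fun s => 2 * HurwitzZeta.hurwitzZetaOdd ((1 / 4 : ℝ) : UnitAddCircle) s :=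
    ((HurwitzZeta.differentiable_hurwitzZetaOdd _).const_mul 2).continuous
  refine congrFun (hc.ext_on (dense_compl_singleton 1) hc' fun s hs => ?_) s
  simp only
  rw [hurwitzRegularPart_of_ne hs, hurwitzRegularPart_of_ne hs, three_quarters_eq_neg_quarter,
    HurwitzZeta.hurwitzZetaOdd_eq]
  ring

/-! ### The sum of the two constants. -/

theorem hurwitzRegularPart_one_apply_of_ne {s : ℂ} (hs : s ≠ 1) :
    hurwitzRegularPart 1 s = riemannZeta s - 1 / (s - 1) := by
  rw [hurwitzRegularPart_of_ne hs, AddCircle.coe_period, HurwitzZeta.hurwitzZeta_zero]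

theorem hurwitzRegularPart_one_one :
    hurwitzRegularPart 1 1 = Real.eulerMascheroniConstant := by
  refine tendsto_nhds_unique (f := hurwitzRegularPart 1) (l := 𝓝[≠] 1)
    ((differentiable_hurwitzRegularPart 1).continuous.tendsto 1 |>.mono_left nhdsWithin_le_nhds) ?_
  refine tendsto_riemannZeta_sub_one_div.congr' ?_
  filter_upwards [self_mem_nhdsWithin] with s hs
  rw [hurwitzRegularPart_one_apply_of_ne hs]

/-- Dividing out a simple zero halves the second derivative. -/
theorem two_mul_deriv_eq_of_sub_mul_eq {F G G' : ℂ → ℂ} {c G'' : ℂ} (hF : Differentiable ℂ F)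
    (h : ∀ s, (s - c) * F s = G s) (hG : ∀ s, HasDerivAt G (G' s) s) (hG' : HasDerivAt G' G'' c) :
    2 * deriv F c = G'' := by
  have h1 : ∀ s, F s + (s - c) * deriv F s = G' s := fun s => by
    have h0 : HasDerivAt (fun s => (s - c) * F s) (1 * F s + (s - c) * deriv F s) s :=
      ((hasDerivAt_id s).sub_const c).mul (hF s).hasDerivAt
    rw [funext h, one_mul] at h0
    exact h0.unique (hG s)
  have h2 : HasDerivAt (fun s => F s + (s - c) * deriv F s)
      (deriv F c + (1 * deriv F c + (c - c) * deriv (deriv F) c)) c :=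
    (hF c).hasDerivAt.add (((hasDerivAt_id c).sub_const c).mul
      (hF.deriv c).hasDerivAt)
  rw [funext h1] at h2
  rw [← h2.unique hG']; ring

theorem deriv_hurwitzRegularPart_quarter_add :
    deriv (hurwitzRegularPart (1 / 4)) 1 + deriv (hurwitzRegularPart (3 / 4)) 1 =
      2 * deriv (hurwitzRegularPart 1) 1 + 6 * Real.log 2 * Real.eulerMascheroniConstant
        + 7 * Real.log 2 ^ 2 := by
  set R := hurwitzRegularPart
  set L : ℂ := (Real.log 2 : ℂ)
  have hR := differentiable_hurwitzRegularPart
  have hL2 : Complex.log 2 = L := by simp [L]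
  have hL4 : Complex.log 4 = 2 * L := by
    rw [show (4 : ℂ) = ((2 ^ 2 : ℝ) : ℂ) by norm_num, ← Complex.ofReal_log (by norm_num),
      Real.log_pow]; push_cast; rfl
  have d4 : ∀ s : ℂ, HasDerivAt (fun s : ℂ => (4 : ℂ) ^ s) ((4 : ℂ) ^ s * (2 * L)) s := fun s => by
    rw [← hL4]; simpa using (hasDerivAt_id s).const_cpow (c := 4) (Or.inl (by norm_num))
  have d2 : ∀ s : ℂ, HasDerivAt (fun s : ℂ => (2 : ℂ) ^ s) ((2 : ℂ) ^ s * L) s := fun s => by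
    rw [← hL2]; simpa using (hasDerivAt_id s).const_cpow (c := 2) (Or.inl (by norm_num))
  have hg : ∀ s, HasDerivAt (fun s : ℂ => (4 : ℂ) ^ s - 2 ^ s) (4 ^ s * (2 * L) - 2 ^ s * L) s :=
    fun s => (d4 s).sub (d2 s)
  set F : ℂ → ℂ := fun s => R (1 / 4) s + R (3 / 4) s - (4 ^ s - 2 ^ s) * R 1 s
  have hF : Differentiable ℂ F := ((hR _).add (hR _)).sub
    (Differentiable.mul (fun s => (hg s).differentiableAt) (hR 1))
  -- The polar parts contribute (4^s - 2^s - 2) / (s - 1), whose numerator vanishes at s = 1; its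
  -- second derivative there, 14 L², is the source of the 7 log² 2.
  have key : ∀ s, (s - 1) * F s = (4 ^ s - 2 ^ s) - 2 := by
    intro s
    rcases eq_or_ne s 1 with rfl | hs
    · norm_num
    · have h := hurwitzZeta_quarter_add hs
      have hs' := sub_ne_zero.mpr hs
      simp only [F, R]
      rw [hurwitzRegularPart_of_ne hs, hurwitzRegularPart_of_ne hs,
        hurwitzRegularPart_one_apply_of_ne hs]
      field_simp
      linear_combination (s - 1) * h
  have h2 := two_mul_deriv_eq_of_sub_mul_eq hF key (fun s => (hg s).sub_const 2)
    (((d4 1).mul_const (2 * L)).sub ((d2 1).mul_const L))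
  have h1 : HasDerivAt F (deriv (R (1 / 4)) 1 + deriv (R (3 / 4)) 1 -
      ((4 ^ (1 : ℂ) * (2 * L) - 2 ^ (1 : ℂ) * L) * R 1 1 + (4 ^ (1 : ℂ) - 2 ^ (1 : ℂ)) *
        deriv (R 1) 1)) 1 :=
    ((hR _ 1).hasDerivAt.add (hR _ 1).hasDerivAt).sub ((hg 1).mul (hR 1 1).hasDerivAt)
  rw [h1.deriv, Complex.cpow_one, Complex.cpow_one,
    show R 1 1 = _ from hurwitzRegularPart_one_one] at h2
  linear_combination h2 / 2

/-! ### A series for the difference, convergent near s = 0. -/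

/-- Terms of the series for `ζ(s, 1/4) - ζ(s, 3/4) - (s / 2) ζ(s + 1)`. -/
noncomputable def quarterTerm (n : ℕ) (s : ℂ) : ℂ :=
  ((n + 1 / 4 : ℝ) : ℂ) ^ (-s) - ((n + 3 / 4 : ℝ) : ℂ) ^ (-s) -
    s / 2 * ((n + 1 : ℝ) : ℂ) ^ (-s - 1)

theorem hasDerivAt_ofReal_cpow_of_pos {y : ℝ} (hy : 0 < y) (w : ℂ) :
    HasDerivAt (fun y : ℝ => (y : ℂ) ^ w) (w * (y : ℂ) ^ (w - 1)) y := by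
  have h := (hasDerivAt_id (y : ℂ)).cpow_const (c := w) (Or.inl (by simpa using hy))
  simpa using h.comp_ofReal

theorem norm_ofReal_cpow_neg_sub_two_le {s : ℂ} (h1 : -1 / 2 < s.re) (h2 : ‖s‖ < 3) {m y : ℝ}
    (hm : 1 / 4 ≤ m) (hy : m ≤ y) : ‖(y : ℂ) ^ (-s - 1 - 1)‖ ≤ 256 * m ^ (-3 / 2 : ℝ) := by
  have h3 : s.re < 3 := (Complex.re_le_norm s).trans_lt h2
  have hy0 : 0 < y := by linarith
  rw [Complex.norm_cpow_eq_rpow_re_of_pos hy0]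
  have e : (-s - 1 - 1).re = -(s.re + 1 / 2) + (-3 / 2) := by
    simp only [Complex.sub_re, Complex.neg_re, Complex.one_re]; ring
  rw [e, Real.rpow_add hy0]
  refine mul_le_mul ?_ (Real.rpow_le_rpow_of_nonpos (by linarith) hy (by norm_num))
    (by positivity) (by norm_num)
  -- The exponent lies in (-7/2, 0) and y ≥ 1/4, so 4^4 = 256 suffices.
  calc y ^ (-(s.re + 1 / 2)) ≤ (1 / 4 : ℝ) ^ (-(s.re + 1 / 2)) :=
        Real.rpow_le_rpow_of_nonpos (by norm_num) (by linarith) (by linarith)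
    _ ≤ (1 / 4 : ℝ) ^ (-4 : ℝ) :=
        Real.rpow_le_rpow_of_exponent_ge (by norm_num) (by norm_num) (by linarith)
    _ = 256 := by
        rw [Real.rpow_neg (by norm_num), show (4 : ℝ) = (4 : ℕ) by norm_num, Real.rpow_natCast]
        norm_num

/-- The subtracted term is the first-order approximation of the difference of powers over a step of
length 1/2, so two mean value estimates gain two powers of n. The constant is 3 · 4 · 256, from the
bounds on s, -s - 1 and the power. -/
theorem norm_quarterTerm_le {s : ℂ} (h1 : -1 / 2 < s.re) (h2 : ‖s‖ < 3) (n : ℕ) :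
    ‖quarterTerm n s‖ ≤ 3072 * (n + 1 / 4 : ℝ) ^ (-3 / 2 : ℝ) := by
  set m : ℝ := n + 1 / 4 with hm
  have hm4 : 1 / 4 ≤ m := by simp [hm]
  set B : ℝ := 256 * m ^ (-3 / 2 : ℝ) with hB
  have hB0 : 0 ≤ B := by positivity
  have hs1 : ‖-s - 1‖ ≤ 4 := by
    calc ‖-s - 1‖ ≤ ‖-s‖ + ‖(1 : ℂ)‖ := norm_sub_le _ _
      _ ≤ 4 := by rw [norm_neg, norm_one]; linarith
  have step1 : ∀ y ∈ Set.Icc m (m + 3 / 4),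
      ‖(y : ℂ) ^ (-s - 1) - ((n + 1 : ℝ) : ℂ) ^ (-s - 1)‖ ≤ 4 * B := by
    intro y hy
    have := (convex_Icc m (m + 3 / 4)).norm_image_sub_le_of_norm_hasDerivWithin_le
      (f := fun y : ℝ => (y : ℂ) ^ (-s - 1)) (C := 4 * B)
      (fun x hx => (hasDerivAt_ofReal_cpow_of_pos (by linarith [hx.1]) _).hasDerivWithinAt)
      (fun x hx => by
        rw [norm_mul]
        exact mul_le_mul hs1 (norm_ofReal_cpow_neg_sub_two_le h1 h2 hm4 hx.1) (norm_nonneg _)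
          (by norm_num))
      (x := n + 1) (y := y) ⟨by linarith, by linarith⟩ hy
    refine this.trans ?_
    have : ‖y - (n + 1)‖ ≤ 1 := by
      rw [Real.norm_eq_abs, abs_le]; constructor <;> linarith [hy.1, hy.2]
    nlinarith
  -- The increment of this function from n + 1/4 to n + 3/4 is exactly the term.
  have step2 := (convex_Icc m (m + 1 / 2)).norm_image_sub_le_of_norm_hasDerivWithin_le
      (f := fun y : ℝ => -(y : ℂ) ^ (-s) - s * ((n + 1 : ℝ) : ℂ) ^ (-s - 1) * (y : ℂ))
      (f' := fun y : ℝ => -(-s * (y : ℂ) ^ (-s - 1)) - s * ((n + 1 : ℝ) : ℂ) ^ (-s - 1) * 1)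
      (C := 3 * (4 * B))
      (fun x hx => ((hasDerivAt_ofReal_cpow_of_pos (by linarith [hx.1]) _).neg.sub
        ((Complex.ofRealCLM.hasDerivAt (x := x)).const_mul _)).hasDerivWithinAt)
      (fun x hx => by
        rw [show -(-s * (x : ℂ) ^ (-s - 1)) - s * ((n + 1 : ℝ) : ℂ) ^ (-s - 1) * 1 =
          s * ((x : ℂ) ^ (-s - 1) - ((n + 1 : ℝ) : ℂ) ^ (-s - 1)) by ring, norm_mul]
        exact mul_le_mul h2.le (step1 x ⟨hx.1, by linarith [hx.2]⟩) (norm_nonneg _)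
          (by norm_num))
      (x := m) (y := m + 1 / 2) ⟨le_rfl, by linarith⟩ ⟨by linarith, le_rfl⟩
  have e : quarterTerm n s = (-((m + 1 / 2 : ℝ) : ℂ) ^ (-s) - s * ((n + 1 : ℝ) : ℂ) ^ (-s - 1) *
      ((m + 1 / 2 : ℝ) : ℂ)) - (-(m : ℂ) ^ (-s) - s * ((n + 1 : ℝ) : ℂ) ^ (-s - 1) * (m : ℂ)) := by
    rw [quarterTerm, show (n + 3 / 4 : ℝ) = m + 1 / 2 by rw [hm]; ring, ← hm]
    push_cast; ring
  rw [e]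
  refine step2.trans ?_
  rw [add_sub_cancel_left, Real.norm_eq_abs, abs_of_pos (by norm_num), hB]
  nlinarith [show 0 ≤ m ^ (-3 / 2 : ℝ) by positivity]

theorem summable_quarter_bound :
    Summable fun n : ℕ => 3072 * (n + 1 / 4 : ℝ) ^ (-3 / 2 : ℝ) := by
  refine Summable.mul_left _ (((Real.summable_one_div_nat_add_rpow (1 / 4) (3 / 2)).mpr
    (by norm_num)).congr fun n => ?_)
  rw [abs_of_pos (by positivity), one_div, ← Real.rpow_neg (by positivity)]
  norm_num

/-- Domain of convergence used for the continuation to a neighbourhood of `0`. -/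
def quarterDomain : Set ℂ := {s | -1 / 2 < s.re} ∩ Metric.ball 0 3

theorem isOpen_quarterDomain : IsOpen quarterDomain :=
  (isOpen_lt continuous_const Complex.continuous_re).inter Metric.isOpen_ball

theorem isPreconnected_quarterDomain : IsPreconnected quarterDomain :=
  ((convex_halfSpace_re_gt (-1 / 2)).inter (convex_ball 0 3)).isPreconnected

theorem hasDerivAt_quarterTerm (n : ℕ) (s : ℂ) : HasDerivAt (quarterTerm n)
    (-((n + 1 / 4 : ℝ) : ℂ) ^ (-s) * Real.log (n + 1 / 4) +
      ((n + 3 / 4 : ℝ) : ℂ) ^ (-s) * Real.log (n + 3 / 4) -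
      (1 / 2 * ((n + 1 : ℝ) : ℂ) ^ (-s - 1) -
        s / 2 * (((n + 1 : ℝ) : ℂ) ^ (-s - 1) * Real.log (n + 1)))) s := by
  have d (x : ℝ) (hx : 0 < x) (c : ℂ) : HasDerivAt (fun s : ℂ => (x : ℂ) ^ (-s - c))
      ((x : ℂ) ^ (-s - c) * Real.log x * -1) s := by
    rw [Complex.ofReal_log hx.le]
    exact ((hasDerivAt_neg s).sub_const c).const_cpow (Or.inl (by exact_mod_cast hx.ne'))
  have d1 := d (n + 1 / 4) (by positivity) 0
  have d2 := d (n + 3 / 4) (by positivity) 0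
  simp only [sub_zero] at d1 d2
  refine ((d1.sub d2).sub (((hasDerivAt_id s).div_const 2).mul
    (d (n + 1) (by positivity) 1))).congr_deriv ?_
  simp only [id]
  ring

theorem differentiableOn_tsum_quarterTerm :
    DifferentiableOn ℂ (fun s => ∑' n, quarterTerm n s) quarterDomain :=
  Complex.differentiableOn_tsum_of_summable_norm summable_quarter_bound
    (fun n s _ => (hasDerivAt_quarterTerm n s).differentiableAt.differentiableWithinAt)
    isOpen_quarterDomain (fun n w hw => norm_quarterTerm_le hw.1 (by simpa using hw.2) n)

theorem hasSum_deriv_quarterTerm :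
    HasSum (fun n : ℕ =>
        ((Real.log (n + 3 / 4) - Real.log (n + 1 / 4) - 1 / 2 * (n + 1 : ℝ)⁻¹ : ℝ) : ℂ))
      (deriv (fun s => ∑' n, quarterTerm n s) 0) := by
  have h := Complex.hasSum_deriv_of_summable_norm (F := quarterTerm) (U := quarterDomain) (z := 0)
    summable_quarter_bound
    (fun n s _ => (hasDerivAt_quarterTerm n s).differentiableAt.differentiableWithinAt)
    isOpen_quarterDomain (fun n w hw => norm_quarterTerm_le hw.1 (by simpa using hw.2) n)
    ⟨by norm_num, by simp⟩
  refine h.congr_fun fun n => ?_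
  rw [(hasDerivAt_quarterTerm n 0).deriv]
  simp only [neg_zero, Complex.cpow_zero, zero_sub, Complex.cpow_neg_one]
  push_cast
  ring

/-- In the difference of the logarithms of Euler's products for Γ(1/4) and Γ(3/4) the factorials
cancel and -(1/2) log N remains, which the harmonic sum absorbs. -/
theorem tendsto_sum_quarter : Tendsto (fun N : ℕ => ∑ n ∈ Finset.range N,
      (Real.log (n + 3 / 4) - Real.log (n + 1 / 4) - 1 / 2 * (n + 1 : ℝ)⁻¹)) atTop
      (𝓝 (Real.log (Real.Gamma (1 / 4)) - Real.log (Real.Gamma (3 / 4)) -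
        1 / 2 * Real.eulerMascheroniConstant)) := by
  -- The product in `Real.GammaSeq a N` has N + 1 factors; `hlog` corrects log (N + 1) to log N.
  rw [← tendsto_add_atTop_iff_nat 1]
  have hl (a : ℝ) (ha : 0 < a) := (Real.GammaSeq_tendsto_Gamma a).log (Real.Gamma_pos_of_pos ha).ne'
  have hH := (tendsto_add_atTop_iff_nat 1).mpr Real.tendsto_harmonic_sub_log
  have hlog : Tendsto (fun N : ℕ => Real.log ((N + 1 : ℕ) : ℝ) - Real.log N) atTop (𝓝 0) := by
    simpa using Real.tendsto_log_nat_add_one_sub_log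
  have := ((hl (1 / 4) (by norm_num)).sub (hl (3 / 4) (by norm_num))).sub
    ((hH.add hlog).const_mul (1 / 2))
  rw [add_zero] at this
  refine this.congr' ?_
  filter_upwards [eventually_gt_atTop 0] with N hN
  have hN' : (0 : ℝ) < N := by exact_mod_cast hN
  have hseq (a : ℝ) (ha : 0 < a) : Real.log (Real.GammaSeq a N) =
      a * Real.log N + Real.log (N.factorial) - ∑ n ∈ Finset.range (N + 1), Real.log (n + a) := by
    have hp : ∀ n ∈ Finset.range (N + 1), a + (n : ℝ) ≠ 0 := fun n _ => by positivity
    rw [Real.GammaSeq, Real.log_div (by positivity) (Finset.prod_ne_zero_iff.mpr hp),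
      Real.log_mul (by positivity) (by positivity), Real.log_rpow hN', Real.log_prod hp]
    simp only [add_comm]
  rw [hseq _ (by norm_num), hseq _ (by norm_num), Finset.sum_sub_distrib, Finset.sum_sub_distrib,
    ← Finset.mul_sum, harmonic]
  push_cast
  ring

theorem deriv_tsum_quarterTerm : deriv (fun s => ∑' n, quarterTerm n s) 0 =
    ((Real.log (Real.Gamma (1 / 4)) - Real.log (Real.Gamma (3 / 4)) -
        1 / 2 * Real.eulerMascheroniConstant : ℝ) : ℂ) := by
  refine tendsto_nhds_unique hasSum_deriv_quarterTerm.tendsto_sum_nat ?_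
  simp_rw [← Complex.ofReal_sum]
  exact (Complex.continuous_ofReal.tendsto _).comp tendsto_sum_quarter

/-- Writing (s/2) ζ(s+1) through the regular part of ζ removes the singularity at s = 0, so the
identity can be continued there. -/
theorem two_mul_hurwitzZetaOdd_quarter_of_one_lt_re {s : ℂ} (hs : 1 < s.re)
    (hU : s ∈ quarterDomain) :
    2 * HurwitzZeta.hurwitzZetaOdd ((1 / 4 : ℝ) : UnitAddCircle) s =
      1 / 2 * (1 + s * hurwitzRegularPart 1 (s + 1)) + ∑' n, quarterTerm n s := by
  have hs0 : s ≠ 0 := by rintro rfl; norm_num at hs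
  have h1 := HurwitzZeta.hasSum_hurwitzZeta_of_one_lt_re (a := 1 / 4) ⟨by norm_num, by norm_num⟩ hs
  have h3 := HurwitzZeta.hasSum_hurwitzZeta_of_one_lt_re (a := 3 / 4) ⟨by norm_num, by norm_num⟩ hs
  have hz := HurwitzZeta.hasSum_hurwitzZeta_of_one_lt_re (a := 1) (s := s + 1)
    ⟨by norm_num, by norm_num⟩ (by simp; linarith)
  have hsum : HasSum (fun n => quarterTerm n s) _ := ((h1.sub h3).sub (hz.mul_left (s / 2))).congr_fun
    fun n => by
      simp only [quarterTerm, one_div, ← Complex.cpow_neg, neg_add']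
      push_cast
      rfl
  rw [hsum.tsum_eq, hurwitzRegularPart_of_ne (by simpa using hs0), HurwitzZeta.hurwitzZetaOdd_eq,
    ← three_quarters_eq_neg_quarter]
  simp only [add_sub_cancel_right]
  field_simp
  ring

theorem two_mul_hurwitzZetaOdd_quarter {s : ℂ} (hs : s ∈ quarterDomain) :
    2 * HurwitzZeta.hurwitzZetaOdd ((1 / 4 : ℝ) : UnitAddCircle) s =
      1 / 2 * (1 + s * hurwitzRegularPart 1 (s + 1)) + ∑' n, quarterTerm n s := by
  have hR : Differentiable ℂ fun s : ℂ => 1 / 2 * (1 + s * hurwitzRegularPart 1 (s + 1)) := by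
    have := (differentiable_hurwitzRegularPart 1).comp (differentiable_id.add_const (1 : ℂ))
    exact (((differentiable_id.mul this).const_add 1).const_mul _)
  have hT := differentiableOn_tsum_quarterTerm
  -- Base point for the identity theorem, inside the half-plane Re s > 1.
  have h2 : (2 : ℂ) ∈ quarterDomain := ⟨by norm_num, by norm_num⟩
  refine AnalyticOnNhd.eqOn_of_preconnected_of_eventuallyEq
    (f := fun s => 2 * HurwitzZeta.hurwitzZetaOdd ((1 / 4 : ℝ) : UnitAddCircle) s)
    (g := fun s => 1 / 2 * (1 + s * hurwitzRegularPart 1 (s + 1)) + ∑' n, quarterTerm n s)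
    (((HurwitzZeta.differentiable_hurwitzZetaOdd _).const_mul 2).differentiableOn.analyticOnNhd
      isOpen_quarterDomain)
    ((hR.differentiableOn.add hT).analyticOnNhd isOpen_quarterDomain)
    isPreconnected_quarterDomain h2 ?_ hs
  filter_upwards [isOpen_quarterDomain.mem_nhds h2,
    (isOpen_lt continuous_const Complex.continuous_re).mem_nhds
      (show (1 : ℝ) < (2 : ℂ).re by norm_num)] with w hw hw1
  exact two_mul_hurwitzZetaOdd_quarter_of_one_lt_re hw1 hw

/-! ### Value and derivative of the difference at s = 0. -/

theorem zero_mem_quarterDomain : (0 : ℂ) ∈ quarterDomain := ⟨by norm_num, by simp⟩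

theorem hurwitzZetaOdd_quarter_zero :
    HurwitzZeta.hurwitzZetaOdd ((1 / 4 : ℝ) : UnitAddCircle) 0 = 1 / 4 := by
  have h := two_mul_hurwitzZetaOdd_quarter zero_mem_quarterDomain
  have h0 : ∀ n, quarterTerm n 0 = 0 := fun n => by simp [quarterTerm]
  simp only [h0, tsum_zero, zero_mul, add_zero] at h
  linear_combination h / 2

theorem deriv_hurwitzZetaOdd_quarter_zero :
    deriv (HurwitzZeta.hurwitzZetaOdd ((1 / 4 : ℝ) : UnitAddCircle)) 0 =
      ((Real.log (Real.Gamma (1 / 4)) - Real.log (Real.Gamma (3 / 4)) : ℝ) : ℂ) / 2 := by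
  have hT := differentiableOn_tsum_quarterTerm
  have hU := isOpen_quarterDomain.mem_nhds zero_mem_quarterDomain
  have hR : HasDerivAt (fun s : ℂ => hurwitzRegularPart 1 (s + 1))
      (deriv (hurwitzRegularPart 1) (0 + 1)) 0 :=
    HasDerivAt.comp_add_const 0 1 (differentiable_hurwitzRegularPart 1 _).hasDerivAt
  have h1 := ((((hasDerivAt_id (0 : ℂ)).mul hR).const_add 1).const_mul (1 / 2)).add
    (hT.differentiableAt hU).hasDerivAt
  have h2 := (HurwitzZeta.differentiable_hurwitzZetaOdd
    ((1 / 4 : ℝ) : UnitAddCircle) 0).hasDerivAt.const_mul 2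
  have h3 := h2.unique (h1.congr_of_eventuallyEq
    (eventually_of_mem hU fun s hs => two_mul_hurwitzZetaOdd_quarter hs))
  -- The γ/2 from the regular part of ζ cancels the -γ/2 from the series.
  rw [deriv_tsum_quarterTerm, zero_add, hurwitzRegularPart_one_one] at h3
  simp only [id] at h3
  push_cast at h3 ⊢
  linear_combination h3 / 2

theorem log_Gamma_three_quarters : Real.log (Real.Gamma (3 / 4)) =
    Real.log Real.pi + 1 / 2 * Real.log 2 - Real.log (Real.Gamma (1 / 4)) := by
  have h := Real.Gamma_mul_Gamma_one_sub (1 / 4)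
  rw [show (1 - 1 / 4 : ℝ) = 3 / 4 by norm_num, show Real.pi * (1 / 4) = Real.pi / 4 by ring,
    Real.sin_pi_div_four] at h
  have h' := congrArg Real.log h
  have h2 : Real.log (√2) = 1 / 2 * Real.log 2 := by rw [Real.log_sqrt (by norm_num)]; ring
  rw [Real.log_mul (Real.Gamma_pos_of_pos (by norm_num)).ne'
    (Real.Gamma_pos_of_pos (by norm_num)).ne', Real.log_div Real.pi_ne_zero (by positivity),
    Real.log_div (by positivity) (by norm_num), h2] at h'
  linarith

/-! ### Transfer from s = 0 to s = 1. -/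

/-- The functional equation of the Dirichlet `L`-function mod 4, in terms of Hurwitz zeta. -/
theorem hurwitzZetaOdd_quarter_one_sub {s : ℂ} (hs : ∀ n : ℕ, s ≠ -n) :
    HurwitzZeta.hurwitzZetaOdd ((1 / 4 : ℝ) : UnitAddCircle) (1 - s) =
      4 * ((8 * Real.pi : ℝ) : ℂ) ^ (-s) * Complex.Gamma s * Complex.sin (Real.pi * s / 2) *
        HurwitzZeta.hurwitzZetaOdd ((1 / 4 : ℝ) : UnitAddCircle) s := by
  rw [HurwitzZeta.hurwitzZetaOdd_one_sub _ hs, sinZeta_quarter,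
    show (8 * Real.pi : ℝ) = 4 * (2 * Real.pi) by ring, Complex.ofReal_mul,
    Complex.mul_cpow_ofReal_nonneg (by norm_num) (by positivity)]
  push_cast
  ring

/-- Differentiating the functional equation at s = 1: the power gives -log(8π), Γ gives -γ, and the
sine is stationary. -/
theorem deriv_hurwitzZetaOdd_quarter_one :
    deriv (HurwitzZeta.hurwitzZetaOdd ((1 / 4 : ℝ) : UnitAddCircle)) 1 =
      ((1 / 2 * Real.pi * (Real.eulerMascheroniConstant + 4 * Real.log 2 + 3 * Real.log Real.pi -
        4 * Real.log (Real.Gamma (1 / 4))) : ℝ) : ℂ) := by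
  have hfe := @hurwitzZetaOdd_quarter_one_sub
  have hzero := hurwitzZetaOdd_quarter_zero
  set Z := HurwitzZeta.hurwitzZetaOdd ((1 / 4 : ℝ) : UnitAddCircle)
  have hZ : Differentiable ℂ Z := HurwitzZeta.differentiable_hurwitzZetaOdd _
  have hpi : (Real.pi : ℂ) ≠ 0 := by exact_mod_cast Real.pi_ne_zero
  have hsin1 : Complex.sin (Real.pi * 1 / 2) = 1 := by rw [mul_one, Complex.sin_pi_div_two]
  have hs1 : ∀ n : ℕ, (1 : ℂ) ≠ -n := fun n h => by
    have := congrArg Complex.re h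
    simp at this
    linarith [n.cast_nonneg (α := ℝ)]
  have hone : Z 1 = Real.pi / 2 := by
    have h := hfe hs1
    rw [sub_self, hzero, Complex.Gamma_one, Complex.cpow_neg_one, mul_one,
      hsin1] at h
    push_cast at h
    field_simp at h
    linear_combination -h / 16
  have hpow : HasDerivAt (fun s : ℂ => ((8 * Real.pi : ℝ) : ℂ) ^ (-s))
      (((8 * Real.pi : ℝ) : ℂ) ^ (-1 : ℂ) * Real.log (8 * Real.pi) * -1) 1 := by
    rw [Complex.ofReal_log (by positivity)]
    exact (hasDerivAt_neg (1 : ℂ)).const_cpow (Or.inl (by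
      exact_mod_cast (by positivity : (8 * Real.pi : ℝ) ≠ 0)))
  have hsin : HasDerivAt (fun s : ℂ => Complex.sin (Real.pi * s / 2)) 0 1 := by
    have := (((hasDerivAt_id (1 : ℂ)).const_mul (Real.pi : ℂ)).div_const 2).csin
    simpa [Complex.cos_pi_div_two] using this
  have hr := (((hpow.const_mul 4).mul Complex.hasDerivAt_Gamma_one).mul hsin).mul (hZ 1).hasDerivAt
  have hl : HasDerivAt (fun s => Z (1 - s)) (-deriv Z (1 - 1)) 1 :=
    HasDerivAt.comp_const_sub 1 1 (hZ _).hasDerivAt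
  have hev : ∀ᶠ s : ℂ in 𝓝 1, ∀ n : ℕ, s ≠ -n := by
    filter_upwards [(isOpen_lt continuous_const Complex.continuous_re).mem_nhds
      (show (0 : ℝ) < (1 : ℂ).re by norm_num)] with s hs n h
    have : 0 < s.re := hs
    rw [h] at this
    simp at this
    linarith [n.cast_nonneg (α := ℝ)]
  have h := hl.unique (hr.congr_of_eventuallyEq
    (hev.mono fun s hs => hfe hs))
  have hlog8 : Real.log (8 * Real.pi) = 3 * Real.log 2 + Real.log Real.pi := by
    rw [show (8 : ℝ) = 2 ^ 3 by norm_num, Real.log_mul (by norm_num) Real.pi_ne_zero, Real.log_pow]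
    norm_num
  simp only [Pi.mul_apply] at h
  rw [sub_self, deriv_hurwitzZetaOdd_quarter_zero, log_Gamma_three_quarters, hone, hlog8,
    Complex.Gamma_one, mul_one, hsin1, Complex.cpow_neg_one] at h
  push_cast at h ⊢
  field_simp at h
  linear_combination -h / 16

/-! ### Combining sum and difference. -/

theorem stieltjesConstant_one (u : ℝ) :
    stieltjesConstant 1 u = -deriv (hurwitzRegularPart u) 1 := by
  simp [stieltjesConstant, iteratedDeriv_one]

theorem deriv_hurwitzRegularPart_quarter_sub :
    deriv (hurwitzRegularPart (1 / 4)) 1 - deriv (hurwitzRegularPart (3 / 4)) 1 =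
      2 * deriv (HurwitzZeta.hurwitzZetaOdd ((1 / 4 : ℝ) : UnitAddCircle)) 1 := by
  have h := (differentiable_hurwitzRegularPart (1 / 4) 1).hasDerivAt.sub
    (differentiable_hurwitzRegularPart (3 / 4) 1).hasDerivAt
  rw [show hurwitzRegularPart (1 / 4) - hurwitzRegularPart (3 / 4) = _ from
    funext hurwitzRegularPart_quarter_sub] at h
  exact h.unique ((HurwitzZeta.differentiable_hurwitzZetaOdd _ 1).hasDerivAt.const_mul 2)

theorem mainTheorem3 :
    stieltjesConstant 1 (1 / 4) =
        1 / 2 * (2 * stieltjesConstant 1 1 - ((7 * Real.log 2 ^ 2 : ℝ) : ℂ) -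
          ((6 * Real.eulerMascheroniConstant * Real.log 2 : ℝ) : ℂ)) -
        ((1 / 2 * Real.pi * (Real.eulerMascheroniConstant + 4 * Real.log 2 + 3 * Real.log Real.pi -
          4 * Real.log (Real.Gamma (1 / 4))) : ℝ) : ℂ) ∧
    stieltjesConstant 1 (3 / 4) =
        1 / 2 * (2 * stieltjesConstant 1 1 - ((7 * Real.log 2 ^ 2 : ℝ) : ℂ) -
          ((6 * Real.eulerMascheroniConstant * Real.log 2 : ℝ) : ℂ)) +
        ((1 / 2 * Real.pi * (Real.eulerMascheroniConstant + 4 * Real.log 2 + 3 * Real.log Real.pi -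
          4 * Real.log (Real.Gamma (1 / 4))) : ℝ) : ℂ) := by

  have hs := deriv_hurwitzRegularPart_quarter_add
  have hd := deriv_hurwitzRegularPart_quarter_sub
  rw [deriv_hurwitzZetaOdd_quarter_one] at hd
  simp only [stieltjesConstant_one]
  push_cast at hs hd ⊢
  constructor
  · linear_combination -(hs + hd) / 2
  · linear_combination -(hs - hd) / 2
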